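/- Work over $\mathbb{C}$. A reducible conic in $\mathbb{P}^n$ means the union of two distinct lines meeting in a point. Let $n \geq 1$ and $d \geq 1$ be integers with $d \geq \frac{3n}{2} - 1$. Then a general hypersurface $X \subset \mathbb{P}^n$ of degree $d$ contains no reducible conics; that is, in the projective space $\mathbb{P}^N$, $N = \binom{n+d}{n} - 1$, parametrizing the hypersurfaces of degree $d$ in $\mathbb{P}^n$ there is a nonempty Zariski open subset $U$ such that no hypersurface $X \in U$ contains a reducible conic. -/

import Mathlib

open scoped LinearAlgebra.Projectivization

namespace GeneralHypersurface

/-- The complex projective space with homogeneous coordinates indexed by `ι`. -/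
abbrev ProjSpace (ι : Type) : Type := ℙ ℂ (ι → ℂ)

/-- The polynomial `G` vanishes at the point `p` of projective space: it is zero on all vectors of
the line in `ℂ^ι` represented by `p`.  For homogeneous `G` this says that `G` is zero at one (hence
at every) vector of homogeneous coordinates of `p`. -/
def VanishesAt {ι : Type} (G : MvPolynomial ι ℂ) (p : ProjSpace ι) : Prop :=
  ∀ v ∈ p.submodule, MvPolynomial.eval v G = 0

/-- `Z` is the common zero locus of a set of homogeneous polynomials. -/
def IsZariskiClosed {ι : Type} (Z : Set (ProjSpace ι)) : Prop :=
  ∃ S : Set (MvPolynomial ι ℂ),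
    (∀ G ∈ S, ∃ k : ℕ, G.IsHomogeneous k) ∧ Z = {p | ∀ G ∈ S, VanishesAt G p}

/-- Zariski open subsets of projective space. -/
def IsZariskiOpen {ι : Type} (U : Set (ProjSpace ι)) : Prop :=
  IsZariskiClosed Uᶜ

/-- The exponents of the monomials of degree `d` in `x₀, …, xₙ`. -/
abbrev Monomials (n d : ℕ) : Type :=
  {m : Fin (n + 1) →₀ ℕ // m ∈ Finset.finsuppAntidiag Finset.univ d}

/-- The form of degree `d` in `x₀, …, xₙ` with coefficient vector `a`. -/
noncomputable def form {n d : ℕ} (a : Monomials n d → ℂ) : MvPolynomial (Fin (n + 1)) ℂ :=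
  ∑ m : Monomials n d, MvPolynomial.monomial m.1 (a m)

/-- The parameter space `ℙ^N`, `N + 1 = (n + d).choose n`, of hypersurfaces of degree `d` in
`ℙ^n`: nonzero forms of degree `d` up to nonzero scalars. -/
abbrev HypersurfaceSpace (n d : ℕ) : Type := ProjSpace (Monomials n d)

/-- The set of points of the hypersurface in `ℙ^n` with parameter `X`. -/
def HypersurfaceSpace.points {n d : ℕ} (X : HypersurfaceSpace n d) :
    Set (ProjSpace (Fin (n + 1))) :=
  {p | ∀ a ∈ X.submodule, VanishesAt (form a) p}

/-- The (straight) lines in projective space. -/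
def IsLine {ι : Type} (ℓ : Set (ProjSpace ι)) : Prop :=
  ∃ W : Submodule ℂ (ι → ℂ), Module.finrank ℂ W = 2 ∧ ℓ = W.projectivization

/-- A reducible conic: the union of two distinct lines that meet (in the node of the conic), hence
lie in a common plane. -/
def IsReducibleConic {ι : Type} (C : Set (ProjSpace ι)) : Prop :=
  ∃ ℓ₁ ℓ₂ : Set (ProjSpace ι),
    IsLine ℓ₁ ∧ IsLine ℓ₂ ∧ ℓ₁ ≠ ℓ₂ ∧ (ℓ₁ ∩ ℓ₂).Nonempty ∧ C = ℓ₁ ∪ ℓ₂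

end GeneralHypersurface

namespace GeneralHypersurface

open MvPolynomial

/-! The proof is a dimension count. A reducible conic depends on 3n − 2 parameters: n for the node
and n − 1 for each direction. Containing a fixed one kills at least 2d + 1 coefficients of a form of
degree d. Since 3n − 2 < 2d + 1, forms containing some reducible conic fill a proper subset of
coefficient space.

To avoid incidence varieties, the count is made in explicit charts, one for each triple of distinct
coordinates i, j, k. A form containing a conic is F(Bx), where F has no monomials in the coordinates
ij or ik alone and B has 3n − 2 free entries (`exists_containsNormalConic`). The coefficients are
thus polynomials in fewer variables than there are coefficients, so they satisfy a nontrivial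
relation (`exists_ne_zero_of_containsNormalConic`). A nonzero homogeneous component of the product
of these relations over all charts cuts out the complement of U. -/

/-! ### Vanishing and dependence of polynomials -/

/-- The image of an affine space under a polynomial map to an affine space of larger dimension
lies in a hypersurface. -/
theorem exists_ne_zero_aeval_eq_zero {σ τ : Type} [Fintype σ] [Fintype τ]
    (h : Fintype.card τ < Fintype.card σ) (φ : σ → MvPolynomial τ ℂ) :
    ∃ G : MvPolynomial σ ℂ, G ≠ 0 ∧ aeval φ G = 0 := by
  by_contra! hG
  -- Without a relation the family would be algebraically independent, and its size is then bounded
  -- by the transcendence degree of the target ring.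
  have hφ : AlgebraicIndependent ℂ φ := by
    rw [algebraicIndependent_iff]
    intro p hp
    by_contra hne
    exact hG p hne hp
  have := hφ.cardinalMk_le_trdeg
  rw [MvPolynomial.trdeg_of_isDomain] at this
  simp only [Cardinal.mk_fintype, Cardinal.lift_natCast, Nat.cast_le] at this
  omega

/-- If a polynomial vanishes on the punctured line through `a`, so do its homogeneous components. -/
theorem eval_homogeneousComponent_eq_zero {σ : Type} {G : MvPolynomial σ ℂ} {a : σ → ℂ}
    (h : ∀ t : ℂ, t ≠ 0 → eval (t • a) G = 0) (k : ℕ) :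
    eval a (homogeneousComponent k G) = 0 := by
  rcases lt_or_ge G.totalDegree k with hk | hk
  · rw [homogeneousComponent_eq_zero k G hk, map_zero]
  -- As a polynomial in t, the value of G at t • a has the values of the components at a as
  -- coefficients.
  let P : Polynomial ℂ := ∑ i ∈ Finset.range (G.totalDegree + 1),
    Polynomial.C (eval a (homogeneousComponent i G)) * Polynomial.X ^ i
  have hP : ∀ t, t ≠ 0 → P.eval t = 0 := by
    intro t ht
    rw [← h t ht]
    conv_rhs => rw [← sum_homogeneousComponent G]
    rw [map_sum, Polynomial.eval_finsetSum]
    refine Finset.sum_congr rfl fun i _ => ?_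
    have hi := homogeneousComponent_isHomogeneous i G
    rw [eval_eq, eval_eq]
    simp only [Polynomial.eval_mul, Polynomial.eval_C, Polynomial.eval_pow, Polynomial.eval_X,
      Finset.sum_mul]
    refine Finset.sum_congr rfl fun m hm => ?_
    have hd := hi.degree_eq_sum_deg_support hm
    simp only [Pi.smul_apply, smul_eq_mul, mul_pow, Finset.prod_mul_distrib,
      Finset.prod_pow_eq_pow_sum]
    rw [hd]
    ring
  have hP0 : P = 0 := by
    refine Polynomial.eq_zero_of_infinite_isRoot P ?_
    refine Set.Infinite.mono (s := {0}ᶜ) (fun t ht => hP t ht) ?_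
    exact (Set.finite_singleton 0).infinite_compl
  have := congrArg (fun Q => Polynomial.coeff Q k) hP0
  simpa [P, Polynomial.finsetSum_coeff, Polynomial.coeff_C_mul, Polynomial.coeff_X_pow,
    Nat.lt_succ_iff.mpr hk, hk] using this

/-- If a polynomial vanishes on a coordinate subspace, then it has no monomials in the
coordinates of that subspace. -/
theorem coeff_eq_zero_of_eval_eq_zero {σ : Type} (s : Finset σ) {F : MvPolynomial σ ℂ}
    (h : ∀ x : σ → ℂ, (∀ i ∉ s, x i = 0) → eval x F = 0) {m : σ →₀ ℕ} (hm : m.support ⊆ s) :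
    coeff m F = 0 := by
  classical
  -- Setting the coordinates outside `s` to zero keeps exactly these monomials.
  let F' : MvPolynomial σ ℂ := ∑ k ∈ F.support with k.support ⊆ s, monomial k (coeff k F)
  have hF' : F' = 0 := by
    refine MvPolynomial.funext_iff.mpr ?_
    intro x
    rw [map_zero, ← h (fun i => if i ∈ s then x i else 0) (fun i hi => if_neg hi)]
    rw [eval_eq (f := F), map_sum, Finset.sum_filter]
    refine Finset.sum_congr rfl fun k _ => ?_
    split_ifs with hk
    · rw [eval_monomial, Finsupp.prod]
      congr 1
      exact Finset.prod_congr rfl fun i hi => by rw [if_pos (hk hi)]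
    · obtain ⟨i, hi, his⟩ := Finset.not_subset.mp hk
      rw [Finset.prod_eq_zero hi, mul_zero]
      rw [if_neg his, zero_pow (Finsupp.mem_support_iff.mp hi)]
  have := congrArg (coeff m) hF'
  simp only [F', coeff_sum, coeff_monomial, coeff_zero, Finset.sum_ite_eq', Finset.mem_filter, mem_support_iff] at this
  by_contra hne
  rw [if_pos ⟨hne, hm⟩] at this
  exact hne this

/-! ### Forms and linear substitutions -/

theorem degree_of_mem_monomials {n d : ℕ} (m : Monomials n d) : m.1.degree = d := by
  have := m.2
  rw [Finset.mem_finsuppAntidiag] at this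
  rw [Finsupp.degree_eq_sum]
  exact this.1

theorem mem_monomials_iff {n d : ℕ} (m : Fin (n + 1) →₀ ℕ) :
    m ∈ Finset.finsuppAntidiag Finset.univ d ↔ m.degree = d := by
  rw [Finset.mem_finsuppAntidiag, Finsupp.degree_eq_sum]
  simp

theorem coeff_form {n d : ℕ} (a : Monomials n d → ℂ) (m : Monomials n d) :
    coeff m.1 (form a) = a m := by
  classical
  simp [form, coeff_sum, coeff_monomial]

theorem form_isHomogeneous {n d : ℕ} (a : Monomials n d → ℂ) : (form a).IsHomogeneous d :=
  IsHomogeneous.sum _ _ _ fun m _ => isHomogeneous_monomial _ (degree_of_mem_monomials m)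

theorem form_coeff {n d : ℕ} {F : MvPolynomial (Fin (n + 1)) ℂ} (hF : F.IsHomogeneous d) :
    form (fun m : Monomials n d => coeff m.1 F) = F := by
  ext m
  by_cases hm : m.degree = d
  · exact coeff_form _ (⟨m, (mem_monomials_iff m).mpr hm⟩ : Monomials n d)
  · rw [hF.coeff_eq_zero hm, (form_isHomogeneous _).coeff_eq_zero hm]

theorem form_smul {n d : ℕ} (t : ℂ) (a : Monomials n d → ℂ) : form (t • a) = C t * form a := by
  simp [form, Finset.mul_sum, C_mul_monomial]

theorem eval_form {n d : ℕ} (a : Monomials n d → ℂ) (x : Fin (n + 1) → ℂ) :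
    eval x (form a) = ∑ m, a m * ∏ i, x i ^ m.1 i := by
  rw [form, map_sum]
  refine Finset.sum_congr rfl fun m _ => ?_
  rw [eval_monomial, Finsupp.prod_fintype _ _ (by simp)]

/-- The polynomial `F` after the linear substitution with matrix `A`. -/
noncomputable def linearSubst {σ : Type} [Fintype σ] (A : Matrix σ σ ℂ) (F : MvPolynomial σ ℂ) :
    MvPolynomial σ ℂ :=
  aeval (fun p => ∑ q, C (A p q) * X q) F

theorem eval_linearSubst {σ : Type} [Fintype σ] (A : Matrix σ σ ℂ) (F : MvPolynomial σ ℂ)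
    (x : σ → ℂ) : eval x (linearSubst A F) = eval (A.mulVec x) F := by
  rw [linearSubst, ← MvPolynomial.coe_aeval_eq_eval, ← MvPolynomial.coe_aeval_eq_eval]
  change (aeval x) _ = aeval _ F
  rw [← AlgHom.comp_apply, comp_aeval]
  congr 2
  ext p
  simp [Matrix.mulVec, dotProduct]

theorem linearSubst_isHomogeneous {σ : Type} [Fintype σ] (A : Matrix σ σ ℂ)
    {F : MvPolynomial σ ℂ} {d : ℕ} (hF : F.IsHomogeneous d) : (linearSubst A F).IsHomogeneous d := by
  have := hF.aeval (fun p => ∑ q, C (A p q) * X q)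
    (fun p => IsHomogeneous.sum _ _ 1 fun q _ => isHomogeneous_C_mul_X _ _)
  rwa [one_mul] at this

/-! ### Dimension count in one chart -/

/-- The positions at which a matrix in normal form may differ from the identity matrix. -/
def freePositions {n : ℕ} (i j k : Fin (n + 1)) : Finset (Fin (n + 1) × Fin (n + 1)) :=
  (Finset.univ.erase i ×ˢ {i, j, k}) \ {(j, j), (k, k)}

/-- Column i has n free entries, columns j and k have n − 1 each: the node and the two directions.
-/
theorem card_freePositions {n : ℕ} {i j k : Fin (n + 1)} (hij : i ≠ j) (hik : i ≠ k)
    (hjk : j ≠ k) : (freePositions i j k).card + 2 = 3 * n := by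
  have hsub : ({(j, j), (k, k)} : Finset (Fin (n + 1) × Fin (n + 1))) ⊆
      Finset.univ.erase i ×ˢ {i, j, k} := by
    intro p hp
    simp only [Finset.mem_insert, Finset.mem_singleton] at hp
    rcases hp with rfl | rfl <;> simp [hij.symm, hik.symm]
  have h1 := Finset.card_sdiff_add_card_eq_card hsub
  rw [Finset.card_pair (by simp [hjk]), Finset.card_product,
    Finset.card_erase_of_mem (Finset.mem_univ i), Finset.card_univ, Fintype.card_fin,
    Finset.card_eq_three.mpr ⟨i, j, k, hij, hik, hjk, rfl⟩] at h1
  rw [freePositions]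
  omega

/-- The monomial `m` does not vanish identically on the conic formed by the coordinate lines
`ij` and `ik`. -/
def IsConicMonomial {n : ℕ} (i j k : Fin (n + 1)) (m : Fin (n + 1) →₀ ℕ) : Prop :=
  m.support ⊆ {i, j} ∨ m.support ⊆ {i, k}

open Classical in
theorem card_conicMonomials {n : ℕ} (d : ℕ) {i j k : Fin (n + 1)} (hij : i ≠ j) (hik : i ≠ k)
    (hjk : j ≠ k) :
    2 * d + 1 ≤ Fintype.card {m : Monomials n d // IsConicMonomial i j k m.1} := by
  -- The shift to r + 1 in the second family avoids counting the d-th power of x_i twice.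
  let f : Fin (d + 1) ⊕ Fin d → Fin (n + 1) →₀ ℕ := Sum.elim
    (fun r => Finsupp.single i (d - r) + Finsupp.single j (r : ℕ))
    (fun r => Finsupp.single i (d - (r + 1)) + Finsupp.single k (r + 1 : ℕ))
  have hsupp : ∀ (l : Fin (n + 1)) (r s : ℕ),
      (Finsupp.single i r + Finsupp.single l s).support ⊆ {i, l} := by
    intro l r s
    refine Finsupp.support_add.trans (Finset.union_subset ?_ ?_)
    · exact Finsupp.support_single_subset.trans (by simp)
    · exact Finsupp.support_single_subset.trans (by simp)
  have hf : ∀ z, f z ∈ Finset.finsuppAntidiag Finset.univ d := by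
    intro z
    rw [mem_monomials_iff]
    rcases z with r | r <;> have := r.2 <;>
      simp only [f, Sum.elim_inl, Sum.elim_inr, map_add, Finsupp.degree_single] <;> omega
  have hconic : ∀ z, IsConicMonomial i j k (f z) := by
    intro z
    rcases z with r | r
    · exact Or.inl (hsupp _ _ _)
    · exact Or.inr (hsupp _ _ _)
  let g : Fin (d + 1) ⊕ Fin d → {m : Monomials n d // IsConicMonomial i j k m.1} :=
    fun z => ⟨⟨f z, hf z⟩, hconic z⟩
  have hg : Function.Injective g := by
    intro y z hyz
    have h : f y = f z := congrArg (fun m => m.1.1) hyz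
    have hj := DFunLike.congr_fun h j
    have hk := DFunLike.congr_fun h k
    rcases y with y | y <;> rcases z with z | z <;>
      simp [f, hij, hik, hjk, hjk.symm] at hj hk ⊢
    · exact Fin.ext hj
    · exact Fin.ext hk
  have := Fintype.card_le_of_injective g hg
  simp only [Fintype.card_sum, Fintype.card_fin] at this
  omega

/-- The hypersurface with coefficients `a` contains the image, under an invertible matrix whose
inverse is in normal form, of the conic formed by the coordinate lines `ij` and `ik`. -/
def ContainsNormalConic {n d : ℕ} (i j k : Fin (n + 1)) (a : Monomials n d → ℂ) : Prop :=
  ∃ A B : Matrix (Fin (n + 1)) (Fin (n + 1)) ℂ, A * B = 1 ∧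
    (∀ p q, (p, q) ∉ freePositions i j k → B p q = (1 : Matrix _ _ ℂ) p q) ∧
    (∀ x : Fin (n + 1) → ℂ, (∀ l ∉ ({i, j} : Finset (Fin (n + 1))), x l = 0) →
      eval (A.mulVec x) (form a) = 0) ∧
    (∀ x : Fin (n + 1) → ℂ, (∀ l ∉ ({i, k} : Finset (Fin (n + 1))), x l = 0) →
      eval (A.mulVec x) (form a) = 0)

open Classical in
theorem exists_ne_zero_of_containsNormalConic {n d : ℕ} (hd : 3 * n ≤ 2 * d + 2)
    {i j k : Fin (n + 1)} (hij : i ≠ j) (hik : i ≠ k) (hjk : j ≠ k) :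
    ∃ G : MvPolynomial (Monomials n d) ℂ, G ≠ 0 ∧
      ∀ a : Monomials n d → ℂ, ContainsNormalConic i j k a → eval a G = 0 := by
  -- Parameters: the free entries of B and the coefficients of F not forced to vanish. `Φ` below is
  -- the generic F(Bx).
  let τ : Type := freePositions i j k ⊕ {m : Monomials n d // ¬ IsConicMonomial i j k m.1}
  let c : Monomials n d → MvPolynomial τ ℂ := fun m =>
    if h : IsConicMonomial i j k m.1 then 0 else X (Sum.inr ⟨m, h⟩)
  let b : Fin (n + 1) → Fin (n + 1) → MvPolynomial τ ℂ := fun p q =>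
    if h : (p, q) ∈ freePositions i j k then X (Sum.inl ⟨(p, q), h⟩)
    else C ((1 : Matrix (Fin (n + 1)) (Fin (n + 1)) ℂ) p q)
  let Φ : MvPolynomial (Fin (n + 1)) (MvPolynomial τ ℂ) :=
    ∑ m : Monomials n d, C (c m) * ∏ p, (∑ q, C (b p q) * X q) ^ m.1 p
  have hcard : Fintype.card τ < Fintype.card (Monomials n d) := by
    have h1 := card_freePositions hij hik hjk
    have h2 := card_conicMonomials d hij hik hjk
    have h3 := Fintype.card_subtype_compl (fun m : Monomials n d => IsConicMonomial i j k m.1)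
    have h4 := Fintype.card_subtype_le (fun m : Monomials n d => IsConicMonomial i j k m.1)
    have h5 : Fintype.card τ = (freePositions i j k).card +
        Fintype.card {m : Monomials n d // ¬ IsConicMonomial i j k m.1} := by
      simp only [τ, Fintype.card_sum, Fintype.card_coe]
    omega
  obtain ⟨G, hG0, hG⟩ := exists_ne_zero_aeval_eq_zero hcard (fun m => coeff m.1 Φ)
  refine ⟨G, hG0, ?_⟩
  rintro a ⟨A, B, hAB, hB, h1, h2⟩
  let F := linearSubst A (form a)
  have hF : F.IsHomogeneous d := linearSubst_isHomogeneous A (form_isHomogeneous a)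
  have hFc : ∀ m, IsConicMonomial i j k m → coeff m F = 0 := by
    rintro m (hm | hm)
    · exact coeff_eq_zero_of_eval_eq_zero _
        (fun x hx => by rw [eval_linearSubst]; exact h1 x hx) hm
    · exact coeff_eq_zero_of_eval_eq_zero _
        (fun x hx => by rw [eval_linearSubst]; exact h2 x hx) hm
  let z : τ → ℂ := Sum.elim (fun p => B p.1.1 p.1.2) (fun m => coeff m.1.1 F)
  have hc : ∀ m, eval z (c m) = coeff m.1 F := by
    intro m
    by_cases h : IsConicMonomial i j k m.1
    · simp [c, h, hFc _ h]
    · simp [c, h, z]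
  have hb : ∀ p q, eval z (b p q) = B p q := by
    intro p q
    by_cases h : (p, q) ∈ freePositions i j k
    · simp [b, h, z]
    · simp only [b, h, dite_false, eval_C]
      exact (hB p q h).symm
  have hΦ : map (eval z) Φ = form a := by
    refine MvPolynomial.funext fun x => ?_
    have hx : eval x (form a) = eval (B.mulVec x) F := by
      rw [eval_linearSubst, Matrix.mulVec_mulVec, hAB, Matrix.one_mulVec]
    rw [hx, ← form_coeff hF, eval_form]
    simp only [Φ, map_sum, map_mul, map_prod, map_pow, map_C, map_X, eval_C, eval_X, hc, hb]
    rfl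
  have ha : ∀ m, eval z (coeff m.1 Φ) = a m := fun m => by
    rw [← coeff_map, hΦ, coeff_form]
  have hGz := congrArg (eval z) hG
  rw [map_zero, ← coe_aeval_eq_eval] at hGz
  change (aeval z) _ = 0 at hGz
  rw [← AlgHom.comp_apply, comp_aeval] at hGz
  rw [← coe_aeval_eq_eval]
  change aeval a G = 0
  rw [← hGz]
  congr 2
  ext m
  exact (ha m).symm

/-! ### Bringing two meeting lines to normal form -/

/-- The jk-block of A has rows (s, αs) and (βs, s). As s(1 − αβ) = 1, its inverse has rows (1, −α)
and (−β, 1), so the scaling by s puts the ones on the diagonal of B. -/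
theorem exists_matrix_of_normalized {n : ℕ} {i j k : Fin (n + 1)} (hij : i ≠ j) (hik : i ≠ k)
    (hjk : j ≠ k) {u v w : Fin (n + 1) → ℂ} {α β s : ℂ} (hs : s * (1 - α * β) = 1)
    (hui : u i = 1) (hvi : v i = 0) (hwi : w i = 0) (hvj : v j = s) (hvk : v k = β * s)
    (hwj : w j = α * s) (hwk : w k = s) :
    ∃ A B : Matrix (Fin (n + 1)) (Fin (n + 1)) ℂ, A * B = 1 ∧
      (∀ p q, (p, q) ∉ freePositions i j k → B p q = (1 : Matrix _ _ ℂ) p q) ∧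
      (∀ x : Fin (n + 1) → ℂ, (∀ l ∉ ({i, j} : Finset (Fin (n + 1))), x l = 0) →
        A.mulVec x = x i • u + x j • v) ∧
      (∀ x : Fin (n + 1) → ℂ, (∀ l ∉ ({i, k} : Finset (Fin (n + 1))), x l = 0) →
        A.mulVec x = x i • u + x k • w) := by
  let e : Fin (n + 1) → Fin (n + 1) → ℂ := fun p q => (1 : Matrix _ _ ℂ) p q
  have he : ∀ p, e p p = 1 := fun p => Matrix.one_apply_eq p
  have he' : ∀ {p q}, p ≠ q → e p q = 0 := fun h => Matrix.one_apply_ne h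
  let κ₁ : Fin (n + 1) → ℂ := fun r => (e j r - u j * e i r) - α * (e k r - u k * e i r)
  let κ₂ : Fin (n + 1) → ℂ := fun r => (e k r - u k * e i r) - β * (e j r - u j * e i r)
  -- A is the identity with columns i, j, k replaced by u, v, w; `κ₁` and `κ₂` are rows j and k of
  -- its inverse.
  let A : Matrix (Fin (n + 1)) (Fin (n + 1)) ℂ := Matrix.of fun p q =>
    e p q + (u p - e p i) * e i q + (v p - e p j) * e j q + (w p - e p k) * e k q
  let B : Matrix (Fin (n + 1)) (Fin (n + 1)) ℂ := Matrix.of fun p r =>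
    e p r - (u p - e p i) * e i r - (v p - e p j) * κ₁ r - (w p - e p k) * κ₂ r
  have hsum : ∀ p (x : Fin (n + 1) → ℂ), ∑ q, e p q * x q = x p := fun p x => by
    simp [e, Matrix.one_apply]
  have hA : ∀ (x : Fin (n + 1) → ℂ) p, ∑ q, A p q * x q =
      x p + (u p - e p i) * x i + (v p - e p j) * x j + (w p - e p k) * x k := by
    intro x p
    simp only [A, Matrix.of_apply, add_mul, Finset.sum_add_distrib, mul_assoc, ← Finset.mul_sum,
      hsum]
  have hBi : ∀ r, B i r = e i r := fun r => by
    simp [B, hui, hvi, hwi, he, he' hij, he' hik]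
  have hBj : ∀ r, B j r = κ₁ r := fun r => by
    simp only [B, κ₁, κ₂, Matrix.of_apply, hvj, hwj, he, he' hij.symm, he' hjk]
    linear_combination (u j * e i r - e j r) * hs
  have hBk : ∀ r, B k r = κ₂ r := fun r => by
    simp only [B, κ₁, κ₂, Matrix.of_apply, hvk, hwk, he, he' hik.symm, he' hjk.symm]
    linear_combination (u k * e i r - e k r) * hs
  refine ⟨A, B, ?_, ?_, ?_, ?_⟩
  · ext p r
    rw [Matrix.mul_apply, hA (fun q => B q r), hBi, hBj, hBk]
    simp only [B, Matrix.of_apply]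
    change _ = e p r
    ring
  · intro p q hpq
    change _ = e p q
    by_cases hp : p = i
    · rw [hp, hBi]
    by_cases hq : q ∈ ({i, j, k} : Finset (Fin (n + 1)))
    · have : (p, q) = (j, j) ∨ (p, q) = (k, k) := by
        by_contra hne
        exact hpq (by simpa [freePositions, hp] using ⟨by simpa using hq, by simpa using hne⟩)
      rcases this with h | h <;> obtain ⟨rfl, rfl⟩ := Prod.mk.inj h
      · rw [hBj]
        simp [κ₁, he, he' hij, he' hjk.symm]
      · rw [hBk]
        simp [κ₂, he, he' hik, he' hjk]
    · simp only [Finset.mem_insert, Finset.mem_singleton, not_or] at hq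
      simp [B, κ₁, κ₂, he' (Ne.symm hq.1), he' (Ne.symm hq.2.1), he' (Ne.symm hq.2.2)]
  · intro x hx
    ext p
    change ∑ q, A p q * x q = _
    have hp : x p = e p i * x i + e p j * x j := by
      by_cases h1 : p = i
      · rw [h1, he, he' hij]; ring
      by_cases h2 : p = j
      · rw [h2, he, he' hij.symm]; ring
      rw [hx p (by simp [h1, h2]), he' h1, he' h2]; ring
    rw [hA, hx k (by simp [hik.symm, hjk.symm]), hp]
    simp only [Pi.add_apply, Pi.smul_apply, smul_eq_mul]
    ring
  · intro x hx
    ext p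
    change ∑ q, A p q * x q = _
    have hp : x p = e p i * x i + e p k * x k := by
      by_cases h1 : p = i
      · rw [h1, he, he' hik]; ring
      by_cases h2 : p = k
      · rw [h2, he, he' hik.symm]; ring
      rw [hx p (by simp [h1, h2]), he' h1, he' h2]; ring
    rw [hA, hx j (by simp [hij.symm, hjk]), hp]
    simp only [Pi.add_apply, Pi.smul_apply, smul_eq_mul]
    ring

/-- Vectors `v` and `w`, not proportional, have a nonzero `2 × 2` minor. -/
theorem exists_minor_ne_zero {ι : Type} {v w : ι → ℂ} (hv : v ≠ 0) (h : ∀ c : ℂ, w ≠ c • v) :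
    ∃ j k, v j * w k - v k * w j ≠ 0 := by
  obtain ⟨j, hj⟩ := Function.ne_iff.mp hv
  by_contra! hz
  refine h (w j / v j) (funext fun k => ?_)
  have hj' : v j ≠ 0 := hj
  simp only [Pi.smul_apply, smul_eq_mul]
  field_simp
  linear_combination hz j k

theorem containsNormalConic_of_lines {n d : ℕ} {a : Monomials n d → ℂ}
    {W₁ W₂ : Submodule ℂ (Fin (n + 1) → ℂ)} {i j k : Fin (n + 1)} {u v w : Fin (n + 1) → ℂ}
    (hu₁ : u ∈ W₁) (hu₂ : u ∈ W₂) (hv : v ∈ W₁) (hw : w ∈ W₂)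
    (hui : u i = 1) (hvi : v i = 0) (hwi : w i = 0) (hvj : v j ≠ 0) (hwk : w k ≠ 0)
    (hD : v j * w k - v k * w j ≠ 0)
    (h₁ : ∀ x ∈ W₁, eval x (form a) = 0) (h₂ : ∀ x ∈ W₂, eval x (form a) = 0) :
    i ≠ j ∧ i ≠ k ∧ j ≠ k ∧ ContainsNormalConic i j k a := by
  have hij : i ≠ j := fun h => hvj (h ▸ hvi)
  have hik : i ≠ k := fun h => hwk (h ▸ hwi)
  have hjk : j ≠ k := fun h => hD (by rw [h]; ring)
  refine ⟨hij, hik, hjk, ?_⟩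
  have h1 : 1 - w j / w k * (v k / v j) ≠ 0 := by
    intro h
    field_simp at h
    exact hD (by linear_combination h)
  set s : ℂ := (1 - w j / w k * (v k / v j))⁻¹ with hs
  obtain ⟨A, B, hAB, hB, hA₁, hA₂⟩ := exists_matrix_of_normalized (u := u) (v := (s / v j) • v)
    (w := (s / w k) • w) (α := w j / w k) (β := v k / v j) (s := s) hij hik hjk
    (inv_mul_cancel₀ h1) hui (by simp [hvi]) (by simp [hwi])
    (by simp [hvj]) (by simp only [Pi.smul_apply, smul_eq_mul]; ring)
    (by simp only [Pi.smul_apply, smul_eq_mul]; ring) (by simp [hwk])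
  refine ⟨A, B, hAB, hB, fun x hx => ?_, fun x hx => ?_⟩
  · rw [hA₁ x hx]
    exact h₁ _ (W₁.add_mem (W₁.smul_mem _ hu₁) (W₁.smul_mem _ (W₁.smul_mem _ hv)))
  · rw [hA₂ x hx]
    exact h₂ _ (W₂.add_mem (W₂.smul_mem _ hu₂) (W₂.smul_mem _ (W₂.smul_mem _ hw)))

theorem exists_containsNormalConic {n d : ℕ} {a : Monomials n d → ℂ}
    {W₁ W₂ : Submodule ℂ (Fin (n + 1) → ℂ)} (hW₁ : Module.finrank ℂ W₁ = 2)
    (hW₂ : Module.finrank ℂ W₂ = 2) (hne : W₁ ≠ W₂) {u : Fin (n + 1) → ℂ} (hu : u ≠ 0)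
    (hu₁ : u ∈ W₁) (hu₂ : u ∈ W₂)
    (h₁ : ∀ x ∈ W₁, eval x (form a) = 0) (h₂ : ∀ x ∈ W₂, eval x (form a) = 0) :
    ∃ i j k : Fin (n + 1), i ≠ j ∧ i ≠ k ∧ j ≠ k ∧ ContainsNormalConic i j k a := by
  obtain ⟨v, hv, hv'⟩ : ∃ v ∈ W₁, v ∉ W₂ := SetLike.not_le_iff_exists.mp fun h =>
    hne (Submodule.eq_of_le_of_finrank_eq h (hW₁.trans hW₂.symm))
  obtain ⟨w, hw, hw'⟩ : ∃ w ∈ W₂, w ∉ W₁ := SetLike.not_le_iff_exists.mp fun h =>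
    hne (Submodule.eq_of_le_of_finrank_eq h (hW₂.trans hW₁.symm)).symm
  obtain ⟨i, hi⟩ := Function.ne_iff.mp hu
  have hi' : u i ≠ 0 := hi
  -- Each direction is moved along the node to make its i-th coordinate zero.
  have hv₁ : v - (v i / u i) • u ∈ W₁ := W₁.sub_mem hv (W₁.smul_mem _ hu₁)
  have hw₁ : w - (w i / u i) • u ∈ W₂ := W₂.sub_mem hw (W₂.smul_mem _ hu₂)
  have hv₂ : v - (v i / u i) • u ≠ 0 := fun h =>
    hv' (by rw [sub_eq_zero.mp h]; exact W₂.smul_mem _ hu₂)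
  have hw₂ : ∀ c : ℂ, w - (w i / u i) • u ≠ c • (v - (v i / u i) • u) := fun c h =>
    hw' (by rw [sub_eq_iff_eq_add.mp h]; exact W₁.add_mem (W₁.smul_mem _ hv₁) (W₁.smul_mem _ hu₁))
  have hvi : (v - (v i / u i) • u) i = 0 := by simp [hi']
  have hwi : (w - (w i / u i) • u) i = 0 := by simp [hi']
  generalize v - (v i / u i) • u = v at *
  generalize w - (w i / u i) • u = w at *
  have hui : ((u i)⁻¹ • u) i = 1 := by simp [hi']
  obtain ⟨j, k, hD⟩ := exists_minor_ne_zero hv₂ hw₂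
  -- One of the two products in the minor is nonzero; if it is the second, j and k trade roles.
  by_cases h : v j * w k = 0
  · have h' : v k * w j ≠ 0 := fun h' => hD (by rw [h, h', sub_zero])
    exact ⟨i, k, j, containsNormalConic_of_lines (W₁.smul_mem _ hu₁) (W₂.smul_mem _ hu₂) hv₁ hw₁
      hui hvi hwi (left_ne_zero_of_mul h') (right_ne_zero_of_mul h')
      (fun h0 => hD (by linear_combination -h0)) h₁ h₂⟩
  · exact ⟨i, j, k, containsNormalConic_of_lines (W₁.smul_mem _ hu₁) (W₂.smul_mem _ hu₂) hv₁ hw₁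
      hui hvi hwi (left_ne_zero_of_mul h) (right_ne_zero_of_mul h) hD h₁ h₂⟩

theorem ContainsNormalConic.smul {n d : ℕ} {i j k : Fin (n + 1)} {a : Monomials n d → ℂ}
    (h : ContainsNormalConic i j k a) (t : ℂ) : ContainsNormalConic i j k (t • a) := by
  obtain ⟨A, B, hAB, hB, h₁, h₂⟩ := h
  refine ⟨A, B, hAB, hB, fun x hx => ?_, fun x hx => ?_⟩
  · rw [form_smul, map_mul, h₁ x hx, mul_zero]
  · rw [form_smul, map_mul, h₂ x hx, mul_zero]

/-! ### The equation of the excluded hypersurfaces -/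

theorem exists_homogeneous_of_containsNormalConic {n d : ℕ} (hd : 3 * n ≤ 2 * d + 2) :
    ∃ (G : MvPolynomial (Monomials n d) ℂ) (r : ℕ), G ≠ 0 ∧ G.IsHomogeneous r ∧
      ∀ a : Monomials n d → ℂ, ∀ i j k : Fin (n + 1), i ≠ j → i ≠ k → j ≠ k →
        ContainsNormalConic i j k a → eval a G = 0 := by
  have h : ∀ p : Fin (n + 1) × Fin (n + 1) × Fin (n + 1),
      ∃ G : MvPolynomial (Monomials n d) ℂ, G ≠ 0 ∧ (p.1 ≠ p.2.1 → p.1 ≠ p.2.2 → p.2.1 ≠ p.2.2 →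
        ∀ a : Monomials n d → ℂ, ContainsNormalConic p.1 p.2.1 p.2.2 a → eval a G = 0) := by
    rintro ⟨i, j, k⟩
    by_cases hijk : i ≠ j ∧ i ≠ k ∧ j ≠ k
    · obtain ⟨G, hG, hG'⟩ := exists_ne_zero_of_containsNormalConic hd hijk.1 hijk.2.1 hijk.2.2
      exact ⟨G, hG, fun _ _ _ => hG'⟩
    · exact ⟨1, one_ne_zero, fun h₁ h₂ h₃ => absurd ⟨h₁, h₂, h₃⟩ hijk⟩
  choose G hG0 hG using h
  have hP : ∏ p, G p ≠ 0 := Finset.prod_ne_zero_iff.mpr fun p _ => hG0 p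
  obtain ⟨r, hr⟩ : ∃ r, homogeneousComponent r (∏ p, G p) ≠ 0 := by
    by_contra! hz
    apply hP
    rw [← sum_homogeneousComponent (∏ p, G p)]
    exact Finset.sum_eq_zero fun r _ => hz r
  refine ⟨_, r, hr, homogeneousComponent_isHomogeneous _ _, fun a i j k hij hik hjk ha => ?_⟩
  refine eval_homogeneousComponent_eq_zero (fun t _ => ?_) r
  rw [map_prod]
  exact Finset.prod_eq_zero (Finset.mem_univ (i, j, k)) (hG (i, j, k) hij hik hjk _ (ha.smul t))

theorem eval_eq_zero_of_line_subset {n d : ℕ} {X : HypersurfaceSpace n d}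
    {W : Submodule ℂ (Fin (n + 1) → ℂ)}
    (hW : (W.projectivization : Set (ProjSpace (Fin (n + 1)))) ⊆ X.points) (hd : d ≠ 0)
    {a : Monomials n d → ℂ} (ha : a ∈ X.submodule) : ∀ x ∈ W, eval x (form a) = 0 := by
  intro x hx
  by_cases hx0 : x = 0
  -- The zero vector gives no projective point; here a form of positive degree has no constant term.
  · rw [hx0, eval_zero, constantCoeff_eq]
    exact (form_isHomogeneous a).coeff_eq_zero (by simpa using hd.symm)
  · have hmem : Projectivization.mk ℂ x hx0 ∈ X.points :=
      hW ((Submodule.mk_mem_projectivization_iff W hx0).mpr hx)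
    refine hmem a ha x ?_
    rw [Projectivization.submodule_mk]
    exact Submodule.mem_span_singleton_self x

end GeneralHypersurface

open GeneralHypersurface in
theorem mainTheorem6 (n d : ℕ) (hd : (3 * n : ℝ) / 2 - 1 ≤ d) :
    ∃ U : Set (GeneralHypersurface.HypersurfaceSpace n d),
      GeneralHypersurface.IsZariskiOpen U ∧ U.Nonempty ∧
        ∀ X ∈ U, ∀ C : Set (GeneralHypersurface.ProjSpace (Fin (n + 1))),
          GeneralHypersurface.IsReducibleConic C → ¬ C ⊆ X.points := by
  have hd' : 3 * n ≤ 2 * d + 2 := by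
    have : (3 * n : ℝ) ≤ 2 * d + 2 := by linarith
    exact_mod_cast this
  obtain ⟨G, r, hG0, hGr, hG⟩ := exists_homogeneous_of_containsNormalConic hd'
  refine ⟨{X | VanishesAt G X}ᶜ, ⟨{G}, by simpa using ⟨r, hGr⟩, by simp⟩, ?_, ?_⟩
  · let m : Monomials n d := ⟨Finsupp.single 0 d, (mem_monomials_iff _).mpr (by simp)⟩
    -- The extra coordinate factor forces `a` to be nonzero, even if `G` is constant.
    obtain ⟨a, ha⟩ : ∃ a, MvPolynomial.eval a (G * MvPolynomial.X m) ≠ 0 := by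
      by_contra! hz
      exact mul_ne_zero hG0 (MvPolynomial.X_ne_zero m)
        (MvPolynomial.funext fun a => by rw [hz a, map_zero])
    rw [map_mul, MvPolynomial.eval_X] at ha
    have ha0 : a ≠ 0 := fun h => right_ne_zero_of_mul ha (by rw [h]; rfl)
    refine ⟨Projectivization.mk ℂ a ha0, fun hX => left_ne_zero_of_mul ha (hX a ?_)⟩
    rw [Projectivization.submodule_mk]
    exact Submodule.mem_span_singleton_self a
  · rintro X hX C ⟨ℓ₁, ℓ₂, ⟨W₁, hW₁, rfl⟩, ⟨W₂, hW₂, rfl⟩, hne, ⟨p, hp₁, hp₂⟩, rfl⟩ hC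
    apply hX
    intro a ha
    have hne' : W₁ ≠ W₂ := fun h => hne (by rw [h])
    induction p using Projectivization.ind with
    | h u hu =>
    -- For d = 0 the bound gives n = 0, and a one-dimensional space contains no plane.
    have hn : d ≠ 0 := by
      rintro rfl
      have h1 := Submodule.finrank_le W₁
      rw [hW₁, Module.finrank_fin_fun] at h1
      omega
    obtain ⟨i, j, k, hij, hik, hjk, h⟩ := exists_containsNormalConic (a := a) hW₁ hW₂ hne' hu hp₁ hp₂
      (eval_eq_zero_of_line_subset (fun q hq => hC (Or.inl hq)) hn ha)
      (eval_eq_zero_of_line_subset (fun q hq => hC (Or.inr hq)) hn ha)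
    exact hG a i j k hij hik hjk h
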